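/- For integers $r\ge 1$, $n\ge 0$ let $H_n^{(r)}=\sum_{k=1}^n k^{-r}$. For integers $p\ge 1$, $q\ge 2$ let $$S_{p,q}=\sum_{n=1}^{\infty}\frac{H_n^{(p)}}{n^q},\qquad \zeta(q,p)=\sum_{n_1>n_2\ge 1}\frac{1}{n_1^{q}n_2^{p}},\qquad \zeta(s)=\sum_{k=1}^\infty \frac1{k^s}\quad(s\ge 2).$$ Then, for all integers $p\ge 1$ and $q\ge 2$, the series defining $S_{p,q}$ and $\zeta(q,p)$ converge and $$S_{p,q}=\zeta(q,p)+\zeta(p+q),$$ and, for all integers $q\ge 2$, $$S_{1,q}=\Big(\frac q2+1\Big)\zeta(q+1)-\frac12\sum_{i=1}^{q-2}\zeta(i+1)\zeta(q-i).$$ In particular, for all integers $p\ge 1$, $q\ge 2$ such that the weight $w=p+q$ is odd, $$S_{p,q}=\frac{1-(-1)^p}{2}\zeta(p)\zeta(q)+\frac12\zeta(w)\Big\{1-(-1)^p\binom{w-1}{q}-(-1)^p\binom{w-1}{p}\Big\}+(-1)^p\sum_{k=1}^{\frac{w-1}{2}}\Big\{\binom{w-2k-1}{p-1}+\binom{w-2k-1}{q-1}\Big\}\zeta(2k)\zeta(w-2k),$$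 where $\zeta(1)$ is interpreted as $0$ wherever it occurs, and $\binom{n}{m}=0$ for $m>n\ge 0$. -/

import Mathlib

/-- The generalized harmonic number `H_n^{(r)} = ∑_{k=1}^n 1 / k^r`, with `H_0^{(r)} = 0`. -/
noncomputable def genHarmonic (r n : ℕ) : ℝ :=
  ∑ k ∈ Finset.Icc 1 n, 1 / (k : ℝ) ^ r

/-- The term of index `n + 1` of the Euler sum of index `(π, q)`, that is,
`H_{n+1}^{(π_1)} ⋯ H_{n+1}^{(π_k)} / (n+1)^q`, where the parts of the partition `π` form a
multiset. -/
noncomputable def eulerSumTerm (π : Multiset ℕ) (q n : ℕ) : ℝ :=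
  (π.map fun r => genHarmonic r (n + 1)).prod / ((n + 1 : ℕ) : ℝ) ^ q

/-- The Euler sum `S_{π,q} = ∑_{n ≥ 1} H_n^{(π_1)} ⋯ H_n^{(π_k)} / n^q`.
The linear Euler sum `S_{p,q}` is `eulerSum {p} q`. -/
noncomputable def eulerSum (π : Multiset ℕ) (q : ℕ) : ℝ :=
  ∑' n : ℕ, eulerSumTerm π q n

/-- The index set of a multiple zeta value of depth `k`: the tuples `n_1 > n_2 > ⋯ > n_k ≥ 1`. -/
abbrev MZVIndex (k : ℕ) : Type :=
  {n : Fin k → ℕ // StrictAnti n ∧ ∀ i, 1 ≤ n i}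

/-- The term `1 / (n_1^{s_1} ⋯ n_k^{s_k})` of a multiple zeta value. -/
noncomputable def mzvTerm {k : ℕ} (s : Fin k → ℕ) (n : MZVIndex k) : ℝ :=
  1 / ∏ i, (n.1 i : ℝ) ^ s i

/-- The multiple zeta value
`ζ(s_1, …, s_k) = ∑_{n_1 > ⋯ > n_k ≥ 1} 1 / (n_1^{s_1} ⋯ n_k^{s_k})`. -/
noncomputable def mzv {k : ℕ} (s : Fin k → ℕ) : ℝ :=
  ∑' n : MZVIndex k, mzvTerm s n

/-- The zeta value `ζ(s) = ∑_{k ≥ 1} 1 / k^s` for an integer `s ≥ 2`, with the convention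
`ζ(1) = 0`. -/
noncomputable def zetaValue (s : ℕ) : ℝ :=
  if s = 1 then 0 else ∑' k : ℕ, 1 / ((k + 1 : ℕ) : ℝ) ^ s

/-- For `s ≥ 2` the zeta value is the value of the Riemann zeta function. -/
theorem zetaValue_eq_riemannZeta (s : ℕ) (hs : 2 ≤ s) :
    ((zetaValue s : ℝ) : ℂ) = riemannZeta s := by
  have h1 : s ≠ 1 := by omega
  rw [zeta_eq_tsum_one_div_nat_add_one_cpow (by simp; omega), zetaValue, if_neg h1,
    Complex.ofReal_tsum]
  refine tsum_congr fun k => ?_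
  rw [Complex.cpow_natCast]
  push_cast
  rfl

/-! Splitting `H_n^{(p)}` into `H_{n-1}^{(p)} + n^{-p}` separates the diagonal `ζ(p+q)` from
`ζ(q,p)`. The rest is double counting, with Lean's `1/0 = 0` deleting the singular terms.

Euler's formula for `S_{1,q}`: the products `ζ(i+1)ζ(q-i)` add up to one double series whose general
term is a finite geometric sum. Off the diagonal that sum closes up into two mirror-image terms,
each summed along a row by telescoping (`hasSum_one_div_pow_mul_sub`); the diagonal gives a multiple
of `ζ(q+1)`.

Odd weight with `p, q ≥ 2`: evaluate `∑_{K ≥ 1} ∑_{n ∈ ℤ} n^{-q} (K-n)^{-p}` in both orders. Summing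
over `K` first produces `((-1)^p - (-1)^q) S_{p,q}` plus zeta values
(`hasSum_int_one_div_pow_mul_fibre`). Summing over `n` first, by partial fractions, leaves only zeta
values (`hasSum_one_div_pow_mul_partialFractions`): odd powers cancel under `n ↦ -n`. For odd weight
the coefficient of `S_{p,q}` is `±2`, so one can solve for it. For `p = 1` the sum over `K`
diverges, and Euler's formula with `q` even is used instead. -/

/-! ### Harmonic numbers and convergence of the linear Euler sums. -/

theorem hasSum_zetaValue {s : ℕ} (hs : 2 ≤ s) :
    HasSum (fun k : ℕ => 1 / ((k : ℝ) + 1) ^ s) (zetaValue s) := by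
  have h : Summable fun k : ℕ => 1 / ((k : ℝ) + 1) ^ s := by
    have := (summable_nat_add_iff 1).2 (Real.summable_one_div_nat_pow.2 (by omega : 1 < s))
    simpa using this
  rw [zetaValue, if_neg (by omega)]
  simpa using h.hasSum

theorem zetaValue_one : zetaValue 1 = 0 := by simp [zetaValue]

theorem genHarmonic_zero (r : ℕ) : genHarmonic r 0 = 0 := by simp [genHarmonic]

theorem genHarmonic_succ (r n : ℕ) :
    genHarmonic r (n + 1) = genHarmonic r n + 1 / ((n : ℝ) + 1) ^ r := by
  rw [genHarmonic, Finset.sum_Icc_succ_top (by omega), genHarmonic]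
  push_cast
  rfl

theorem genHarmonic_eq_sum_range (r n : ℕ) :
    genHarmonic r n = ∑ k ∈ Finset.range n, 1 / ((k : ℝ) + 1) ^ r := by
  induction n with
  | zero => simp [genHarmonic_zero]
  | succ n ih => rw [genHarmonic_succ, Finset.sum_range_succ, ih]

theorem genHarmonic_nonneg (r n : ℕ) : 0 ≤ genHarmonic r n := by
  rw [genHarmonic]; positivity

/-- A crude bound suffices: it dominates the Euler sum by `2 ∑ n^{-3/2}` as soon as `q ≥ 2`. -/
theorem genHarmonic_le_two_mul_sqrt {r : ℕ} (hr : 1 ≤ r) (n : ℕ) :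
    genHarmonic r n ≤ 2 * √(n : ℝ) := by
  induction n with
  | zero => simp [genHarmonic_zero]
  | succ n ih =>
    rw [genHarmonic_succ]
    push_cast
    have hn : (0 : ℝ) ≤ n := n.cast_nonneg
    have h1 : 1 / ((n : ℝ) + 1) ^ r ≤ 1 / ((n : ℝ) + 1) := by
      apply one_div_le_one_div_of_le (by positivity)
      exact le_self_pow₀ (by linarith) (by omega)
    set s := √(n : ℝ)
    set t := √((n : ℝ) + 1)
    have hs : s ^ 2 = n := Real.sq_sqrt hn
    have ht : t ^ 2 = n + 1 := Real.sq_sqrt (by positivity)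
    have hs0 : 0 ≤ s := Real.sqrt_nonneg _
    have ht1 : 1 ≤ t := Real.one_le_sqrt.2 (by linarith)
    have hst : s ≤ t := Real.sqrt_le_sqrt (by linarith)
    have h2 : 1 / ((n : ℝ) + 1) ≤ 2 * t - 2 * s := by
      rw [div_le_iff₀ (by positivity), ← ht]
      have h3 : (t - s) * (t + s) = 1 := by linear_combination ht - hs
      nlinarith [mul_nonneg (sub_nonneg.2 hst) (sub_nonneg.2 hst),
        mul_nonneg (sub_nonneg.2 hst) (mul_nonneg (by linarith : 0 ≤ t) (sub_nonneg.2 ht1)),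
        mul_nonneg (sub_nonneg.2 hst) (by linarith : 0 ≤ t)]
    linarith

theorem eulerSumTerm_singleton (p q n : ℕ) :
    eulerSumTerm {p} q n = genHarmonic p (n + 1) / ((n : ℝ) + 1) ^ q := by
  simp [eulerSumTerm]

theorem summable_eulerSumTerm {p q : ℕ} (hp : 1 ≤ p) (hq : 2 ≤ q) :
    Summable (eulerSumTerm {p} q) := by
  have h : Summable fun n : ℕ => 2 * (1 / ((n + 1 : ℕ) : ℝ) ^ (3 / 2 : ℝ)) :=
    ((summable_nat_add_iff 1).2
      (Real.summable_one_div_nat_rpow.2 (by norm_num : (1 : ℝ) < 3 / 2))).mul_left 2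
  refine h.of_nonneg_of_le (fun n => ?_) fun n => ?_
  · rw [eulerSumTerm_singleton]
    have := genHarmonic_nonneg p (n + 1)
    positivity
  · rw [eulerSumTerm_singleton]
    have hx : (1 : ℝ) ≤ (n + 1 : ℕ) := by simp
    have h1 := genHarmonic_le_two_mul_sqrt hp (n + 1)
    have hn : (n : ℝ) + 1 = (n + 1 : ℕ) := by push_cast; rfl
    rw [hn]
    set x : ℝ := ((n + 1 : ℕ) : ℝ)
    have hx0 : 0 < x := by linarith
    have h2 : x ^ 2 ≤ x ^ q := pow_le_pow_right₀ hx hq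
    have h3 : √x * x ^ (3 / 2 : ℝ) = x ^ 2 := by
      rw [Real.sqrt_eq_rpow, ← Real.rpow_add hx0, ← Real.rpow_natCast]
      norm_num
    rw [mul_one_div, div_le_div_iff₀ (by positivity) (by positivity)]
    calc genHarmonic p (n + 1) * x ^ (3 / 2 : ℝ) ≤ 2 * √x * x ^ (3 / 2 : ℝ) := by gcongr
      _ = 2 * x ^ 2 := by rw [mul_assoc, h3]
      _ ≤ 2 * x ^ q := by gcongr

theorem hasSum_eulerSum {p q : ℕ} (hp : 1 ≤ p) (hq : 2 ≤ q) :
    HasSum (fun n : ℕ => genHarmonic p (n + 1) / ((n : ℝ) + 1) ^ q) (eulerSum {p} q) := by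
  have h := (summable_eulerSumTerm hp hq).hasSum
  simp only [funext (eulerSumTerm_singleton p q)] at h
  simpa only [eulerSum, funext (eulerSumTerm_singleton p q)] using h

theorem hasSum_genHarmonic_div {p q : ℕ} (hp : 1 ≤ p) (hq : 2 ≤ q) :
    HasSum (fun n : ℕ => genHarmonic p n / ((n : ℝ) + 1) ^ q)
      (eulerSum {p} q - zetaValue (p + q)) := by
  refine ((hasSum_eulerSum hp hq).sub (hasSum_zetaValue (by omega : 2 ≤ p + q))).congr_fun ?_
  intro n
  rw [genHarmonic_succ, pow_add]
  field_simp
  ring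

/-! ### The double zeta value. -/

/-- The pairs `n₁ > n₂ ≥ 1`, listed by `n₁ = n + 1` and `n₂ ≤ n`. -/
def sigmaFinEquivMZVIndex : (Σ n : ℕ, Fin n) ≃ MZVIndex 2 where
  toFun x := ⟨![x.1 + 1, x.2 + 1], by
    refine ⟨?_, ?_⟩
    · intro i j hij
      fin_cases i <;> fin_cases j <;> simp_all
    · intro i
      fin_cases i <;> simp⟩
  invFun y := ⟨y.1 0 - 1, ⟨y.1 1 - 1, by
    have h1 := y.2.1 (show (0 : Fin 2) < 1 by decide)
    have h2 := y.2.2 1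
    omega⟩⟩
  left_inv x := by simp
  right_inv y := by
    have h0 := y.2.2 0
    have h1 := y.2.2 1
    apply Subtype.ext
    funext i
    fin_cases i <;> simp <;> omega

theorem hasSum_mzvTerm_pair {p q : ℕ} (hp : 1 ≤ p) (hq : 2 ≤ q) :
    HasSum (mzvTerm ![q, p]) (eulerSum {p} q - zetaValue (p + q)) := by
  rw [← sigmaFinEquivMZVIndex.hasSum_iff]
  have hterm : ∀ x : Σ n : ℕ, Fin n, (mzvTerm ![q, p] ∘ sigmaFinEquivMZVIndex) x
      = 1 / ((x.2 : ℕ) + 1 : ℝ) ^ p / ((x.1 : ℝ) + 1) ^ q := by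
    intro x
    simp [sigmaFinEquivMZVIndex, mzvTerm, Fin.prod_univ_two]
    ring
  have hfib : ∀ n : ℕ, ∑ j : Fin n, 1 / ((j : ℕ) + 1 : ℝ) ^ p / ((n : ℝ) + 1) ^ q
      = genHarmonic p n / ((n : ℝ) + 1) ^ q := by
    intro n
    rw [genHarmonic_eq_sum_range, Finset.sum_div, ← Fin.sum_univ_eq_sum_range
      (fun k => 1 / ((k : ℝ) + 1) ^ p / ((n : ℝ) + 1) ^ q)]
  have hS := hasSum_genHarmonic_div hp hq
  rw [funext hterm]
  have hsum : Summable fun x : Σ n : ℕ, Fin n =>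
      1 / ((x.2 : ℕ) + 1 : ℝ) ^ p / ((x.1 : ℝ) + 1) ^ q := by
    rw [summable_sigma_of_nonneg (fun x => by positivity)]
    refine ⟨fun n => (hasSum_fintype _).summable, ?_⟩
    simp only [tsum_fintype, hfib]
    exact hS.summable
  have h := hsum.hasSum.sigma fun n => by
    simpa only [hfib] using hasSum_fintype
      fun j : Fin n => 1 / ((j : ℕ) + 1 : ℝ) ^ p / ((n : ℝ) + 1) ^ q
  exact hS.unique h ▸ hsum.hasSum

/-! ### Euler's formula for `S_{1,q}`. -/

theorem hasSum_sub_shift_of_tendsto_zero {f : ℕ → ℝ} (hf : Antitone f)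
    (h0 : Filter.Tendsto f Filter.atTop (nhds 0)) : HasSum (fun n => f n - f (n + 1)) (f 0) := by
  rw [hasSum_iff_tendsto_nat_of_nonneg (fun n => sub_nonneg.2 (hf n.le_succ))]
  simp only [Finset.sum_range_sub']
  simpa using h0.const_sub (f 0)

theorem hasSum_one_div_sub_one_div_shift (k : ℕ) :
    HasSum (fun n : ℕ => 1 / ((n : ℝ) + 1) - 1 / ((n : ℝ) + 1 + k)) (genHarmonic 1 k) := by
  induction k with
  | zero => simp [genHarmonic_zero]
  | succ k ih =>
    have hanti : Antitone fun n : ℕ => 1 / ((n : ℝ) + 1 + k) := by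
      intro m n hmn
      have : (m : ℝ) ≤ n := by exact_mod_cast hmn
      dsimp only
      gcongr
    have hlim : Filter.Tendsto (fun n : ℕ => 1 / ((n : ℝ) + 1 + k)) Filter.atTop (nhds 0) := by
      have := (tendsto_one_div_atTop_nhds_zero_nat (𝕜 := ℝ)).comp (Filter.tendsto_add_atTop_nat (1 + k))
      refine this.congr fun n => ?_
      simp [add_assoc]
    have h := ih.add (hasSum_sub_shift_of_tendsto_zero hanti hlim)
    rw [genHarmonic_succ]
    convert h using 1
    · funext n
      push_cast
      ring
    · simp
      ring

/-- The summand is `(1/(b+1) + 1/(a-b))/(a+1)`, and `b ↦ a-1-b` turns the second fraction into the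
first. -/
theorem sum_range_one_div_mul_reflect (a : ℕ) :
    ∑ b ∈ Finset.range a, 1 / (((b : ℝ) + 1) * ((a : ℝ) - b))
      = 2 * genHarmonic 1 a / ((a : ℝ) + 1) := by
  have h1 : ∀ b ∈ Finset.range a, 1 / (((b : ℝ) + 1) * ((a : ℝ) - b))
      = (1 / ((b : ℝ) + 1) + 1 / (((a - 1 - b : ℕ) : ℝ) + 1)) / ((a : ℝ) + 1) := by
    intro b hb
    have hb := Finset.mem_range.1 hb
    obtain ⟨c, rfl⟩ := Nat.exists_eq_add_of_lt hb
    rw [show b + c + 1 - 1 - b = c by omega]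
    push_cast
    have : (b : ℝ) + c + 1 - b ≠ 0 := by
      have : (0 : ℝ) ≤ c := c.cast_nonneg
      linarith
    have h2 : (b : ℝ) + c + 1 + 1 ≠ 0 := by positivity
    have h3 : (b : ℝ) + c + 1 - b = c + 1 := by ring
    rw [h3]
    field_simp
    ring
  rw [Finset.sum_congr rfl h1, ← Finset.sum_div, Finset.sum_add_distrib,
    Finset.sum_range_reflect (fun k => 1 / ((k : ℝ) + 1)), genHarmonic_eq_sum_range]
  simp only [pow_one]
  ring

theorem hasSum_one_div_mul_shift (a : ℕ) :
    HasSum (fun c : ℕ => 1 / (((c : ℝ) + 1) * ((c : ℝ) + a + 2)))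
      (genHarmonic 1 (a + 1) / ((a : ℝ) + 1)) := by
  refine ((hasSum_one_div_sub_one_div_shift (a + 1)).div_const ((a : ℝ) + 1)).congr_fun ?_
  intro c
  push_cast
  have : (c : ℝ) + a + 2 ≠ 0 := by positivity
  have : (c : ℝ) + 1 + (a + 1) ≠ 0 := by positivity
  field_simp
  ring

/-- The term `b = a` is `1/0 = 0`. The tail `b > a` telescopes, and the head `b < a` is the
reflected finite sum with a minus sign. -/
theorem hasSum_one_div_mul_sub (a : ℕ) :
    HasSum (fun b : ℕ => 1 / (((b : ℝ) + 1) * ((b : ℝ) - a)))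
      ((genHarmonic 1 (a + 1) - 2 * genHarmonic 1 a) / ((a : ℝ) + 1)) := by
  have h : HasSum (fun c : ℕ => 1 / ((((c + (a + 1) : ℕ) : ℝ) + 1) * (((c + (a + 1) : ℕ) : ℝ) - a)))
      (genHarmonic 1 (a + 1) / ((a : ℝ) + 1)) := by
    refine (hasSum_one_div_mul_shift a).congr_fun fun c => ?_
    push_cast
    congr 1
    ring
  have h2 := (hasSum_nat_add_iff (f := fun b : ℕ => 1 / (((b : ℝ) + 1) * ((b : ℝ) - a))) (a + 1)).1 h
  refine (congrArg (HasSum _) ?_).mp h2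
  symm
  rw [Finset.sum_range_succ, sub_self, mul_zero, div_zero, add_zero, sub_div,
    ← sum_range_one_div_mul_reflect, sub_eq_add_neg, ← Finset.sum_neg_distrib]
  congr 1
  refine Finset.sum_congr rfl fun b _ => ?_
  rw [← neg_sub (b : ℝ) a, mul_neg, div_neg, neg_neg]

/-- Taking absolute values only flips the sign of the head; this gives the absolute convergence
needed to exchange sums. -/
theorem hasSum_abs_one_div_mul_sub (a : ℕ) :
    HasSum (fun b : ℕ => |1 / (((b : ℝ) + 1) * ((b : ℝ) - a))|)
      ((genHarmonic 1 (a + 1) + 2 * genHarmonic 1 a) / ((a : ℝ) + 1)) := by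
  have h : HasSum (fun c : ℕ =>
      |1 / ((((c + (a + 1) : ℕ) : ℝ) + 1) * (((c + (a + 1) : ℕ) : ℝ) - a))|)
      (genHarmonic 1 (a + 1) / ((a : ℝ) + 1)) := by
    refine (hasSum_one_div_mul_shift a).congr_fun fun c => ?_
    have : (((c + (a + 1) : ℕ) : ℝ) + 1) * (((c + (a + 1) : ℕ) : ℝ) - a)
        = ((c : ℝ) + 1) * ((c : ℝ) + a + 2) := by push_cast; ring
    rw [this, abs_of_nonneg (by positivity)]
  have h2 := (hasSum_nat_add_iff
    (f := fun b : ℕ => |1 / (((b : ℝ) + 1) * ((b : ℝ) - a))|) (a + 1)).1 h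
  refine (congrArg (HasSum _) ?_).mp h2
  symm
  rw [Finset.sum_range_succ, sub_self, mul_zero, div_zero, abs_zero, add_zero, add_div,
    ← sum_range_one_div_mul_reflect]
  congr 1
  refine Finset.sum_congr rfl fun b hb => ?_
  have hb : (b : ℝ) < a := by exact_mod_cast Finset.mem_range.1 hb
  rw [← neg_sub (a : ℝ) b, mul_neg, div_neg, abs_neg, abs_of_nonneg]
  have : 0 ≤ (a : ℝ) - b := by linarith
  positivity

theorem hasSum_one_div_pow_mul_sub (q : ℕ) :
    HasSum (fun x : ℕ × ℕ =>
        1 / ((x.1 : ℝ) + 1) ^ (q + 1) * (1 / (((x.2 : ℝ) + 1) * ((x.2 : ℝ) - x.1))))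
      (2 * zetaValue (q + 3) - eulerSum {1} (q + 2)) := by
  have h0 := hasSum_eulerSum (p := 1) (q := q + 2) le_rfl (by omega)
  have h1 := hasSum_genHarmonic_div (p := 1) (q := q + 2) le_rfl (by omega)
  have hs : Summable fun x : ℕ × ℕ =>
      1 / ((x.1 : ℝ) + 1) ^ (q + 1) * (1 / (((x.2 : ℝ) + 1) * ((x.2 : ℝ) - x.1))) := by
    rw [← summable_abs_iff, summable_prod_of_nonneg (fun x => abs_nonneg _)]
    have hfib := fun a : ℕ =>
      (hasSum_abs_one_div_mul_sub a).mul_left (1 / ((a : ℝ) + 1) ^ (q + 1))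
    have habs : ∀ a b : ℕ, |1 / ((a : ℝ) + 1) ^ (q + 1) * (1 / (((b : ℝ) + 1) * ((b : ℝ) - a)))|
        = 1 / ((a : ℝ) + 1) ^ (q + 1) * |1 / (((b : ℝ) + 1) * ((b : ℝ) - a))| := by
      intro a b
      rw [abs_mul, abs_of_nonneg (by positivity : 0 ≤ 1 / ((a : ℝ) + 1) ^ (q + 1))]
    simp only [habs]
    refine ⟨fun a => (hfib a).summable, ?_⟩
    simp only [fun a => (hfib a).tsum_eq]
    refine (h0.add (h1.mul_left 2)).summable.congr fun a => ?_
    field_simp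
    ring
  have h2 := hs.hasSum.prod_fiberwise fun a =>
    (hasSum_one_div_mul_sub a).mul_left (1 / ((a : ℝ) + 1) ^ (q + 1))
  have h3 := h0.sub (h1.mul_left 2)
  have h4 := h2.unique (h3.congr_fun fun a => by field_simp; ring)
  rw [show 2 * zetaValue (q + 3) - eulerSum {1} (q + 2) = eulerSum {1} (q + 2)
    - 2 * (eulerSum {1} (q + 2) - zetaValue (1 + (q + 2))) by
      rw [show 1 + (q + 2) = q + 3 by omega]; ring, ← h4]
  exact hs.hasSum

/-- With `x = 1/(a+1)`, `y = 1/(b+1)`, the sum is `(xy)^2 (x^q - y^q)/(x - y)` off the diagonal,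
where `x - y = xy(b - a)`. On the diagonal the two fractions vanish and all `q` summands agree. -/
theorem sum_range_one_div_pow_mul_one_div_pow (q a b : ℕ) :
    ∑ i ∈ Finset.range q, 1 / ((a : ℝ) + 1) ^ (i + 2) * (1 / ((b : ℝ) + 1) ^ (q + 1 - i))
      = 1 / ((a : ℝ) + 1) ^ (q + 1) * (1 / (((b : ℝ) + 1) * ((b : ℝ) - a)))
        + 1 / ((b : ℝ) + 1) ^ (q + 1) * (1 / (((a : ℝ) + 1) * ((a : ℝ) - b)))
        + if a = b then (q : ℝ) * (1 / ((a : ℝ) + 1) ^ (q + 3)) else 0 := by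
  split_ifs with hab
  · subst hab
    simp only [sub_self, mul_zero, div_zero, zero_add]
    rw [Finset.sum_congr rfl (g := fun _ => 1 / ((a : ℝ) + 1) ^ (q + 3))]
    · simp
    · intro i hi
      have hi := Finset.mem_range.1 hi
      rw [one_div_mul_one_div, ← pow_add]
      congr 2
      omega
  · have hne : (a : ℝ) - b ≠ 0 := sub_ne_zero.2 (by exact_mod_cast hab)
    have hne' : (b : ℝ) - a ≠ 0 := by rwa [← neg_sub, neg_ne_zero]
    set x : ℝ := 1 / ((a : ℝ) + 1) with hx
    set y : ℝ := 1 / ((b : ℝ) + 1) with hy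
    have hxy : x - y = x * y * ((b : ℝ) - a) := by
      rw [hx, hy]
      field_simp
      ring
    have h := geom_sum₂_mul x y q
    have hsum : ∑ i ∈ Finset.range q,
        1 / ((a : ℝ) + 1) ^ (i + 2) * (1 / ((b : ℝ) + 1) ^ (q + 1 - i))
        = (x * y) ^ 2 * ∑ i ∈ Finset.range q, x ^ i * y ^ (q - 1 - i) := by
      rw [Finset.mul_sum]
      refine Finset.sum_congr rfl fun i hi => ?_
      have hi := Finset.mem_range.1 hi
      rw [hx, hy, ← one_div_pow, ← one_div_pow, show q + 1 - i = q - 1 - i + 2 by omega]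
      ring
    have hx0 : x ≠ 0 := by rw [hx]; positivity
    have hy0 : y ≠ 0 := by rw [hy]; positivity
    have hr1 : 1 / (((b : ℝ) + 1) * ((b : ℝ) - a)) = y / ((b : ℝ) - a) := by
      rw [hy]; field_simp
    have hr2 : 1 / (((a : ℝ) + 1) * ((a : ℝ) - b)) = - x / ((b : ℝ) - a) := by
      rw [hx, ← neg_sub (b : ℝ) a]; field_simp
    rw [hsum, hr1, hr2, ← one_div_pow, ← one_div_pow, ← hx, ← hy]
    rw [hxy] at h
    field_simp
    linear_combination (x * y) * h

theorem eulerSum_one_add_two (q : ℕ) :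
    eulerSum {1} (q + 2) = ((q : ℝ) / 2 + 2) * zetaValue (q + 3)
      - 1 / 2 * ∑ i ∈ Finset.range q, zetaValue (i + 2) * zetaValue (q + 1 - i) := by
  have hB := hasSum_one_div_pow_mul_sub q
  have hB' := (Equiv.prodComm ℕ ℕ).hasSum_iff.2 hB
  have hD : HasSum (fun x : ℕ × ℕ =>
      if x.1 = x.2 then (q : ℝ) * (1 / ((x.1 : ℝ) + 1) ^ (q + 3)) else 0)
      (q * zetaValue (q + 3)) := by
    have hinj : Function.Injective fun n : ℕ => (n, n) := fun m n h => (Prod.ext_iff.1 h).1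
    rw [← hinj.hasSum_iff]
    · simpa [Function.comp_def] using (hasSum_zetaValue (by omega : 2 ≤ q + 3)).mul_left (q : ℝ)
    · rintro ⟨a, b⟩ hx
      rw [if_neg]
      exact fun hab => hx ⟨a, Prod.ext rfl hab⟩
  have hR := (hB.add hB').add hD
  have hL : HasSum (fun x : ℕ × ℕ => ∑ i ∈ Finset.range q,
      1 / ((x.1 : ℝ) + 1) ^ (i + 2) * (1 / ((x.2 : ℝ) + 1) ^ (q + 1 - i)))
      (∑ i ∈ Finset.range q, zetaValue (i + 2) * zetaValue (q + 1 - i)) := by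
    refine hasSum_sum fun i hi => ?_
    have hi := Finset.mem_range.1 hi
    have h1 := hasSum_zetaValue (by omega : 2 ≤ i + 2)
    have h2 := hasSum_zetaValue (by omega : 2 ≤ q + 1 - i)
    exact h1.mul h2 (h1.summable.mul_of_nonneg h2.summable (fun _ => by positivity)
      fun _ => by positivity)
  have h := hL.unique (hR.congr_fun fun x => sum_range_one_div_pow_mul_one_div_pow q x.1 x.2)
  linarith

/-! ### Sums of inverse powers over the integers. -/

theorem hasSum_int_one_div_pow {s : ℕ} (hs : 2 ≤ s) :
    HasSum (fun n : ℤ => (1 / (n : ℝ)) ^ s) ((1 + (-1) ^ s) * zetaValue s) := by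
  have h := hasSum_zetaValue hs
  have h1 : HasSum (fun n : ℕ => (1 / (((n : ℤ) + 1 : ℤ) : ℝ)) ^ s) (zetaValue s) := by
    refine h.congr_fun fun n => ?_
    push_cast
    rw [one_div_pow]
  have h2 : HasSum (fun n : ℕ => (1 / ((-((n : ℤ) + 1) : ℤ) : ℝ)) ^ s)
      ((-1) ^ s * zetaValue s) := by
    refine (h.mul_left ((-1) ^ s)).congr_fun fun n => ?_
    push_cast
    rw [one_div_neg_eq_neg_one_div, neg_pow, one_div_pow]
  have h3 := HasSum.of_add_one_of_neg_add_one (f := fun n : ℤ => (1 / (n : ℝ)) ^ s) h1 h2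
  refine (congrArg (HasSum _) ?_).mp h3
  have : s ≠ 0 := by omega
  simp [this]
  ring

theorem hasSum_int_one_div_const_sub_pow {s : ℕ} (hs : 2 ≤ s) (K : ℕ) :
    HasSum (fun n : ℤ => (1 / ((K : ℝ) - n)) ^ s) ((1 + (-1) ^ s) * zetaValue s) := by
  have h := (Equiv.subLeft (K : ℤ)).hasSum_iff.2 (hasSum_int_one_div_pow hs)
  refine h.congr_fun fun n => ?_
  simp

theorem hasSum_int_one_div_sub_one_div_sub_one :
    HasSum (fun n : ℤ => 1 / (n : ℝ) - 1 / ((n : ℝ) - 1)) 0 := by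
  have h := hasSum_one_div_sub_one_div_shift 1
  have hH : genHarmonic 1 1 = 1 := by simp [genHarmonic]
  rw [hH] at h
  have h1 : HasSum (fun n : ℕ => 1 / (((n : ℤ) + 1 : ℤ) : ℝ) - 1 / ((((n : ℤ) + 1 : ℤ) : ℝ) - 1))
      0 := by
    rw [← hasSum_nat_add_iff' 1]
    refine (congrArg (HasSum _) ?_).mp (h.neg.congr_fun fun n => ?_)
    · simp
    · push_cast
      ring
  have h2 : HasSum (fun n : ℕ => 1 / ((-((n : ℤ) + 1) : ℤ) : ℝ)
      - 1 / (((-((n : ℤ) + 1) : ℤ) : ℝ) - 1)) (-1) := by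
    refine h.neg.congr_fun fun n => ?_
    push_cast
    rw [show -((n : ℝ) + 1) - 1 = -((n : ℝ) + 1 + 1) by ring, one_div_neg_eq_neg_one_div,
      one_div_neg_eq_neg_one_div]
    ring
  have h3 := HasSum.of_add_one_of_neg_add_one
    (f := fun n : ℤ => 1 / (n : ℝ) - 1 / ((n : ℝ) - 1)) h1 h2
  refine (congrArg (HasSum _) ?_).mp h3
  simp

/-- Handles the simple poles, whose separate sums do not converge absolutely. Passing from `K` to `K
+ 1` adds a translate of a telescoping series of sum `0`. -/
theorem hasSum_int_one_div_add_one_div_const_sub (K : ℕ) :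
    HasSum (fun n : ℤ => 1 / (n : ℝ) + 1 / ((K : ℝ) - n)) 0 := by
  induction K with
  | zero =>
    refine hasSum_zero.congr_fun fun n => ?_
    rw [Nat.cast_zero, zero_sub, one_div_neg_eq_neg_one_div, add_neg_cancel]
  | succ K ih =>
    have h := (Equiv.subRight (K : ℤ)).hasSum_iff.2 hasSum_int_one_div_sub_one_div_sub_one
    refine (congrArg (HasSum _) (add_zero 0)).mp ((ih.add h).congr_fun fun n => ?_)
    simp only [Function.comp_apply, Equiv.subRight_apply]
    push_cast
    rw [← neg_sub (n : ℝ) ((K : ℝ) + 1), ← neg_sub (n : ℝ) (K : ℝ), one_div_neg_eq_neg_one_div,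
      one_div_neg_eq_neg_one_div, sub_sub (n : ℝ)]
    ring

/-! ### Partial fractions over a commutative ring. -/

section PartialFractions

variable {R : Type*} [CommRing R]

/-- The part in `u` of the partial fraction expansion of `u ^ (N - a + 1) * v ^ (a + 1)`, where
`u`, `v`, `t` are the inverses of `x`, `y`, `x + y`. -/
def partialFractionPart (N a : ℕ) (u t : R) : R :=
  ∑ x ∈ Finset.HasAntidiagonal.antidiagonal N, (x.2.choose a : R) * u ^ (x.1 + 1) * t ^ (x.2 + 1)

theorem partialFractionPart_zero_right (N : ℕ) (u t : R) :
    partialFractionPart (N + 1) 0 u t = t * (u ^ (N + 2) + partialFractionPart N 0 u t) := by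
  simp only [partialFractionPart, Finset.Nat.sum_antidiagonal_succ', Nat.choose_zero_right,
    mul_add, Finset.mul_sum]
  congr 1
  · simp
    ring
  · refine Finset.sum_congr rfl fun x _ => ?_
    ring

theorem partialFractionPart_succ_succ (N a : ℕ) (u t : R) :
    partialFractionPart (N + 1) (a + 1) u t
      = t * (partialFractionPart N a u t + partialFractionPart N (a + 1) u t) := by
  simp only [partialFractionPart, Finset.Nat.sum_antidiagonal_succ', Nat.choose_zero_succ,
    ← Finset.sum_add_distrib, Finset.mul_sum, Nat.cast_zero, zero_mul, zero_add]
  refine Finset.sum_congr rfl fun x _ => ?_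
  rw [Nat.choose_succ_succ]
  push_cast
  ring

theorem partialFractionPart_of_lt {N a : ℕ} (h : N < a) (u t : R) :
    partialFractionPart N a u t = 0 := by
  refine Finset.sum_eq_zero fun x hx => ?_
  have := Finset.HasAntidiagonal.mem_antidiagonal.1 hx
  rw [Nat.choose_eq_zero_of_lt (by omega)]
  simp

theorem partialFractionPart_self (N : ℕ) (u t : R) :
    partialFractionPart N N u t = u * t ^ (N + 1) := by
  induction N with
  | zero => simp [partialFractionPart]
  | succ N ih =>
    rw [partialFractionPart_succ_succ, ih, partialFractionPart_of_lt N.lt_succ_self]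
    ring

theorem partialFractionPart_zero_left (N a : ℕ) (t : R) : partialFractionPart N a 0 t = 0 :=
  Finset.sum_eq_zero fun x _ => by simp

/-- The hockey-stick identity. It gives the value of the expansion at the deleted points `n = 0` and
`n = K`, where one of `u`, `v` is `0` and the other equals `t`. -/
theorem partialFractionPart_diag (N a : ℕ) (t : R) :
    partialFractionPart N a t t = ((N + 1).choose (a + 1) : R) * t ^ (N + 2) := by
  have h : ∀ N, ∑ x ∈ Finset.HasAntidiagonal.antidiagonal N, x.2.choose a = (N + 1).choose (a + 1) := by
    intro N
    induction N with
    | zero => cases a <;> simp [Nat.choose_eq_zero_of_lt]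
    | succ N ih =>
      rw [Finset.Nat.sum_antidiagonal_succ, ih, Nat.choose_succ_succ (N + 1)]
  rw [← h, Nat.cast_sum, Finset.sum_mul, partialFractionPart]
  refine Finset.sum_congr rfl fun x hx => ?_
  rw [← Finset.HasAntidiagonal.mem_antidiagonal.1 hx]
  ring

theorem pow_succ_mul_eq_partialFractionPart {u v t : R} (h : u * v = t * (u + v)) (b : ℕ) :
    u ^ (b + 1) * v = partialFractionPart b 0 u t + partialFractionPart b b v t := by
  rw [partialFractionPart_self]
  induction b with
  | zero =>
    simp [partialFractionPart]
    linear_combination h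
  | succ b ih =>
    rw [partialFractionPart_zero_right]
    linear_combination u ^ (b + 1) * h + t * ih

/-- Replacing one factor `uv` by `t(u + v)` lowers an exponent on each side; the parts obey the same
recursion by Pascal's rule. -/
theorem pow_succ_mul_pow_succ_eq_partialFractionPart {u v t : R} (h : u * v = t * (u + v))
    (a b : ℕ) : u ^ (b + 1) * v ^ (a + 1)
      = partialFractionPart (a + b) a u t + partialFractionPart (a + b) b v t := by
  induction a generalizing b with
  | zero => simpa using pow_succ_mul_eq_partialFractionPart h b
  | succ a iha =>
    induction b with
    | zero =>
      have := pow_succ_mul_eq_partialFractionPart (u := v) (v := u) (t := t)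
        (by linear_combination h) (a + 1)
      simp only [zero_add, pow_one, add_zero]
      linear_combination this
    | succ b ihb =>
      have h1 := iha (b + 1)
      rw [show a + 1 + b = a + (b + 1) by omega] at ihb
      rw [show a + 1 + (b + 1) = a + (b + 1) + 1 by omega, partialFractionPart_succ_succ,
        partialFractionPart_succ_succ]
      linear_combination (u ^ (b + 1) * v ^ (a + 1)) * h + t * h1 + t * ihb

end PartialFractions

/-! ### The sum over `n` for fixed `K`. -/

theorem one_div_pow_mul_one_div_const_sub_pow (a b K : ℕ) (hK : K ≠ 0) (n : ℤ) :
    (1 / (n : ℝ)) ^ (b + 1) * (1 / ((K : ℝ) - n)) ^ (a + 1)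
      = partialFractionPart (a + b) a (1 / (n : ℝ)) (1 / (K : ℝ))
        + partialFractionPart (a + b) b (1 / ((K : ℝ) - n)) (1 / (K : ℝ))
        - (if n = 0 then ((a + b + 1).choose (b + 1) : ℝ) * (1 / (K : ℝ)) ^ (a + b + 2) else 0)
        - (if n = K then ((a + b + 1).choose (a + 1) : ℝ) * (1 / (K : ℝ)) ^ (a + b + 2) else 0) := by
  have hK' : (K : ℝ) ≠ 0 := by exact_mod_cast hK
  by_cases h0 : n = 0
  · have : (0 : ℤ) ≠ K := by omega
    simp [h0, this, -one_div, -inv_pow, partialFractionPart_zero_left, partialFractionPart_diag]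
  by_cases h1 : n = K
  · simp [h1, hK, -one_div, -inv_pow, partialFractionPart_zero_left, partialFractionPart_diag]
  · rw [if_neg h0, if_neg h1, sub_zero, sub_zero]
    apply pow_succ_mul_pow_succ_eq_partialFractionPart
    have h2 : (n : ℝ) ≠ 0 := by exact_mod_cast h0
    have h3 : (K : ℝ) - n ≠ 0 := sub_ne_zero.2 (by exact_mod_cast Ne.symm h1)
    field_simp
    ring

theorem hasSum_int_one_div_pow_mul_one_div_const_sub_pow {a b M : ℕ} (hM : a + b = M + 1) (K : ℕ)
    (hK : K ≠ 0) :
    HasSum (fun n : ℤ => (1 / (n : ℝ)) ^ (b + 1) * (1 / ((K : ℝ) - n)) ^ (a + 1))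
      (∑ x ∈ Finset.HasAntidiagonal.antidiagonal M, ((x.2.choose a : ℝ) + x.2.choose b)
          * ((1 + (-1) ^ (x.1 + 2)) * zetaValue (x.1 + 2)) * (1 / (K : ℝ)) ^ (x.2 + 1)
        - (((M + 2).choose (b + 1) : ℝ) + (M + 2).choose (a + 1)) * (1 / (K : ℝ)) ^ (M + 3)) := by
  set t : ℝ := 1 / (K : ℝ) with ht
  -- The simple poles at `n = 0` and `n = K` have the same coefficient, so they pair up as `1/n +
  -- 1/(K-n)`.
  have hsym : (M + 1).choose b = (M + 1).choose a := by
    rw [← hM, Nat.choose_symm_add]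
  have h1 := (hasSum_int_one_div_add_one_div_const_sub K).mul_left
    (((M + 1).choose a : ℝ) * t ^ (M + 2))
  have h2 : HasSum (fun n : ℤ => ∑ x ∈ Finset.HasAntidiagonal.antidiagonal M,
      ((x.2.choose a : ℝ) * (1 / (n : ℝ)) ^ (x.1 + 2)
        + (x.2.choose b : ℝ) * (1 / ((K : ℝ) - n)) ^ (x.1 + 2)) * t ^ (x.2 + 1))
      (∑ x ∈ Finset.HasAntidiagonal.antidiagonal M, ((x.2.choose a : ℝ) + x.2.choose b)
          * ((1 + (-1) ^ (x.1 + 2)) * zetaValue (x.1 + 2)) * t ^ (x.2 + 1)) := by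
    refine hasSum_sum fun x _ => ?_
    have h := (((hasSum_int_one_div_pow (by omega : 2 ≤ x.1 + 2)).mul_left (x.2.choose a : ℝ)).add
      ((hasSum_int_one_div_const_sub_pow (by omega : 2 ≤ x.1 + 2) K).mul_left
        (x.2.choose b : ℝ))).mul_right (t ^ (x.2 + 1))
    rwa [← add_mul] at h
  have h3 := hasSum_ite_eq (0 : ℤ) (((M + 2).choose (b + 1) : ℝ) * t ^ (M + 3))
  have h4 := hasSum_ite_eq (K : ℤ) (((M + 2).choose (a + 1) : ℝ) * t ^ (M + 3))
  refine (congrArg (HasSum _) ?_).mp ((((h1.add h2).sub h3).sub h4).congr_fun fun n => ?_)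
  · ring
  · rw [one_div_pow_mul_one_div_const_sub_pow a b K hK n, hM, ← ht]
    congr 2
    rw [partialFractionPart, partialFractionPart, ← Finset.sum_add_distrib,
      Finset.Nat.sum_antidiagonal_succ]
    congr 1
    · simp only [hsym]
      ring
    · refine Finset.sum_congr rfl fun x _ => ?_
      ring

/-! ### The double series over `(K, n)`, evaluated in both orders. -/

theorem hasSum_one_div_sub_pow {s : ℕ} (hs : 2 ≤ s) (m : ℕ) :
    HasSum (fun k : ℕ => (1 / ((k : ℝ) - m)) ^ s) (zetaValue s + (-1) ^ s * genHarmonic s m) := by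
  have h : HasSum (fun c : ℕ => (1 / (((c + (m + 1) : ℕ) : ℝ) - m)) ^ s) (zetaValue s) := by
    refine (hasSum_zetaValue hs).congr_fun fun c => ?_
    rw [← one_div_pow]
    push_cast
    congr 2
    ring
  have h2 := (hasSum_nat_add_iff (f := fun k : ℕ => (1 / ((k : ℝ) - m)) ^ s) (m + 1)).1 h
  refine (congrArg (HasSum _) ?_).mp h2
  have hs0 : s ≠ 0 := by omega
  rw [Finset.sum_range_succ, sub_self, div_zero, zero_pow hs0, add_zero, genHarmonic_eq_sum_range,
    ← Finset.sum_range_reflect, Finset.mul_sum]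
  congr 1
  refine Finset.sum_congr rfl fun k hk => ?_
  obtain ⟨c, rfl⟩ := Nat.exists_eq_add_of_lt (Finset.mem_range.1 hk)
  rw [show k + c + 1 - 1 - k = c by omega, ← one_div_pow, ← mul_pow]
  congr 1
  push_cast
  rw [show (c : ℝ) - (k + c + 1) = -(k + 1) by ring, one_div_neg_eq_neg_one_div]
  ring

theorem hasSum_one_div_add_pow {s : ℕ} (hs : 2 ≤ s) (m : ℕ) :
    HasSum (fun k : ℕ => (1 / ((k : ℝ) + 1 + m)) ^ s) (zetaValue s - genHarmonic s m) := by
  rw [genHarmonic_eq_sum_range]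
  refine ((hasSum_nat_add_iff' m).2 (hasSum_zetaValue hs)).congr_fun fun k => ?_
  rw [← one_div_pow]
  push_cast
  congr 2
  ring

theorem summable_one_div_pow_mul_one_div_sub_pow {p q : ℕ} (hp : 2 ≤ p) (hq : 2 ≤ q) :
    Summable fun x : ℕ × ℤ => (1 / (x.2 : ℝ)) ^ q * (1 / (((x.1 + 1 : ℕ) : ℝ) - x.2)) ^ p := by
  have h : Summable fun x : ℤ × ℤ => (1 / (x.1 : ℝ)) ^ q * (1 / (x.2 : ℝ)) ^ p :=
    summable_mul_of_summable_norm (f := fun n : ℤ => (1 / (n : ℝ)) ^ q)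
      (g := fun n : ℤ => (1 / (n : ℝ)) ^ p) (hasSum_int_one_div_pow hq).summable.norm
      (hasSum_int_one_div_pow hp).summable.norm
  -- In the coordinates `(n, K - n)` the family is part of a product of two absolutely convergent
  -- series.
  have hinj : Function.Injective fun x : ℕ × ℤ => (x.2, ((x.1 + 1 : ℕ) : ℤ) - x.2) := by
    rintro ⟨a, b⟩ ⟨c, d⟩ h
    simp only [Prod.mk.injEq] at h ⊢
    omega
  refine (h.comp_injective hinj).congr fun x => ?_
  simp

theorem hasSum_int_one_div_pow_mul_fibre {p q : ℕ} (hp : 2 ≤ p) (hq : 2 ≤ q) :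
    HasSum (fun x : ℕ × ℤ => (1 / (x.2 : ℝ)) ^ q * (1 / (((x.1 + 1 : ℕ) : ℝ) - x.2)) ^ p)
      ((1 + (-1) ^ q) * (zetaValue p * zetaValue q)
        + (-1) ^ p * (eulerSum {p} q - zetaValue (p + q)) - (-1) ^ q * eulerSum {p} q) := by
  have hs := (summable_one_div_pow_mul_one_div_sub_pow hp hq).hasSum
  set T := ∑' x : ℕ × ℤ, (1 / (x.2 : ℝ)) ^ q * (1 / (((x.1 + 1 : ℕ) : ℝ) - x.2)) ^ p
  have hfib : ∀ n : ℤ, HasSum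
      (fun k : ℕ => (1 / (n : ℝ)) ^ q * (1 / (((k + 1 : ℕ) : ℝ) - n)) ^ p)
      (∑' k : ℕ, (1 / (n : ℝ)) ^ q * (1 / (((k + 1 : ℕ) : ℝ) - n)) ^ p) := fun n =>
    (((Equiv.prodComm ℤ ℕ).hasSum_iff.2 hs).summable.prod_factor n).hasSum
  have h := HasSum.prod_fiberwise ((Equiv.prodComm ℤ ℕ).hasSum_iff.2 hs) hfib
  have hζ := hasSum_zetaValue hq
  have hpos : HasSum (fun m : ℕ => ∑' k : ℕ, (1 / (((m : ℤ) + 1 : ℤ) : ℝ)) ^ q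
      * (1 / (((k + 1 : ℕ) : ℝ) - (((m : ℤ) + 1 : ℤ) : ℝ))) ^ p)
      (zetaValue p * zetaValue q + (-1) ^ p * (eulerSum {p} q - zetaValue (p + q))) := by
    refine ((hζ.mul_left (zetaValue p)).add ((hasSum_genHarmonic_div (by omega : 1 ≤ p)
      hq).mul_left ((-1) ^ p))).congr_fun fun m => ?_
    rw [tsum_mul_left]
    have h1 := (hasSum_one_div_sub_pow hp m).tsum_eq
    push_cast
    simp only [add_sub_add_right_eq_sub]
    rw [h1, one_div_pow]
    ring
  have hneg : HasSum (fun m : ℕ => ∑' k : ℕ, (1 / ((-((m : ℤ) + 1) : ℤ) : ℝ)) ^ q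
      * (1 / (((k + 1 : ℕ) : ℝ) - ((-((m : ℤ) + 1) : ℤ) : ℝ))) ^ p)
      ((-1) ^ q * (zetaValue p * zetaValue q - eulerSum {p} q)) := by
    refine (((hζ.mul_left (zetaValue p)).sub (hasSum_eulerSum (by omega : 1 ≤ p)
      hq)).mul_left ((-1) ^ q)).congr_fun fun m => ?_
    rw [tsum_mul_left]
    have h1 := (hasSum_one_div_add_pow hp (m + 1)).tsum_eq
    push_cast at h1 ⊢
    simp only [sub_neg_eq_add, h1]
    rw [one_div_neg_eq_neg_one_div, neg_pow, one_div_pow]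
    ring
  have h' := HasSum.of_add_one_of_neg_add_one (f := fun n : ℤ => ∑' k : ℕ, (1 / (n : ℝ)) ^ q
    * (1 / (((k + 1 : ℕ) : ℝ) - n)) ^ p) hpos hneg
  have hT := h.unique h'
  refine (congrArg (HasSum _) ?_).mp hs
  rw [hT]
  have hq0 : q ≠ 0 := by omega
  simp [hq0]
  ring

theorem hasSum_one_div_pow_mul_partialFractions {a b M : ℕ} (ha : 1 ≤ a) (hb : 1 ≤ b)
    (hM : a + b = M + 1) :
    HasSum (fun x : ℕ × ℤ =>
        (1 / (x.2 : ℝ)) ^ (b + 1) * (1 / (((x.1 + 1 : ℕ) : ℝ) - x.2)) ^ (a + 1))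
      (∑ x ∈ Finset.HasAntidiagonal.antidiagonal M, ((x.2.choose a : ℝ) + x.2.choose b)
          * ((1 + (-1) ^ (x.1 + 2)) * zetaValue (x.1 + 2)) * zetaValue (x.2 + 1)
        - (((M + 2).choose (b + 1) : ℝ) + (M + 2).choose (a + 1)) * zetaValue (M + 3)) := by
  have hs := (summable_one_div_pow_mul_one_div_sub_pow (by omega : 2 ≤ a + 1)
    (by omega : 2 ≤ b + 1)).hasSum
  have h := hs.prod_fiberwise fun k =>
    hasSum_int_one_div_pow_mul_one_div_const_sub_pow hM (k + 1) k.succ_ne_zero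
  have hζ : ∀ {s : ℕ}, 2 ≤ s → HasSum (fun k : ℕ => (1 / ((k + 1 : ℕ) : ℝ)) ^ s) (zetaValue s) := by
    intro s hs
    refine (hasSum_zetaValue hs).congr_fun fun k => ?_
    push_cast
    rw [one_div_pow]
  have h1 := (hasSum_sum (s := Finset.HasAntidiagonal.antidiagonal M) (f := fun x (k : ℕ) =>
      ((x.2.choose a : ℝ) + x.2.choose b) * ((1 + (-1) ^ (x.1 + 2)) * zetaValue (x.1 + 2))
        * (1 / ((k + 1 : ℕ) : ℝ)) ^ (x.2 + 1))
      (a := fun x => ((x.2.choose a : ℝ) + x.2.choose b)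
        * ((1 + (-1) ^ (x.1 + 2)) * zetaValue (x.1 + 2)) * zetaValue (x.2 + 1)) fun x _ => by
    -- At `x.2 = 0` the sum over `K` would be harmonic, but both binomials vanish since `a, b ≥ 1`.
    rcases Nat.eq_zero_or_pos x.2 with hx | hx
    · simp [hx, Nat.choose_eq_zero_of_lt ha, Nat.choose_eq_zero_of_lt hb]
    · exact (hζ (by omega)).mul_left _).sub
    ((hζ (by omega : 2 ≤ M + 3)).mul_left
      (((M + 2).choose (b + 1) : ℝ) + (M + 2).choose (a + 1)))
  exact h.unique h1 ▸ hs

/-! ### Reindexing and the odd-weight formula. -/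

theorem sum_range_of_odd_eq_zero {R : Type*} [AddCommMonoid R] (f : ℕ → R)
    (hf : ∀ i, f (2 * i + 1) = 0) (n : ℕ) :
    ∑ i ∈ Finset.range (2 * n + 1), f i = ∑ i ∈ Finset.range (n + 1), f (2 * i) := by
  induction n with
  | zero => simp
  | succ n ih =>
    rw [show 2 * (n + 1) + 1 = 2 * n + 1 + 1 + 1 by ring, Finset.sum_range_succ,
      Finset.sum_range_succ, ih, hf, add_zero, Finset.sum_range_succ _ (n + 1)]
    rfl

theorem sum_Icc_one_eq_sum_range {R : Type*} [AddCommMonoid R] (f : ℕ → R) (n : ℕ) :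
    ∑ k ∈ Finset.Icc 1 n, f k = ∑ k ∈ Finset.range n, f (k + 1) := by
  induction n with
  | zero => simp
  | succ n ih => rw [Finset.sum_Icc_succ_top (by omega), ih, Finset.sum_range_succ]

/-- The reflection `i ↦ 2n-1-i` exchanges even and odd indices. -/
theorem sum_range_two_mul_of_symm (f : ℕ → ℝ) (n : ℕ)
    (hf : ∀ i < 2 * n, f (2 * n - 1 - i) = f i) :
    ∑ i ∈ Finset.range (2 * n), f i = 2 * ∑ i ∈ Finset.range n, f (2 * i) := by
  have h : ∀ m, ∑ i ∈ Finset.range (2 * m), f i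
      = ∑ i ∈ Finset.range m, f (2 * i) + ∑ i ∈ Finset.range m, f (2 * i + 1) := by
    intro m
    induction m with
    | zero => simp
    | succ m ih =>
      rw [mul_add_one, Finset.sum_range_succ, Finset.sum_range_succ, ih, Finset.sum_range_succ,
        Finset.sum_range_succ]
      ring
  rw [h, two_mul, ← Finset.sum_range_reflect (fun i => f (2 * i + 1))]
  congr 1
  refine Finset.sum_congr rfl fun i hi => ?_
  have hi := Finset.mem_range.1 hi
  rw [← hf (2 * i) (by omega)]
  congr 1
  omega

theorem eulerSum_one {q : ℕ} (hq : 2 ≤ q) :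
    eulerSum {1} q = ((q : ℝ) / 2 + 1) * zetaValue (q + 1)
      - 1 / 2 * ∑ i ∈ Finset.Icc 1 (q - 2), zetaValue (i + 1) * zetaValue (q - i) := by
  obtain ⟨n, rfl⟩ := Nat.exists_eq_add_of_le' hq
  rw [eulerSum_one_add_two, sum_Icc_one_eq_sum_range, Nat.add_sub_cancel]
  congr 1
  · push_cast
    ring
  · congr 1
    refine Finset.sum_congr rfl fun i _ => ?_
    rw [show n + 2 - (i + 1) = n + 1 - i by omega]

theorem eulerSum_one_of_even (n : ℕ) :
    eulerSum {1} (2 * n + 2) = ((n : ℝ) + 2) * zetaValue (2 * n + 3)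
      - ∑ r ∈ Finset.range (n + 1), zetaValue (2 * r + 2) * zetaValue (2 * n + 1 - 2 * r) := by
  -- The extra index `r = n` on the right contributes `ζ(1) = 0`.
  rw [eulerSum_one_add_two, sum_range_two_mul_of_symm, Finset.sum_range_succ,
    show 2 * n + 1 - 2 * n = 1 by omega, zetaValue_one]
  · push_cast
    ring
  · intro i hi
    rw [show 2 * n - 1 - i + 2 = 2 * n + 1 - i by omega,
      show 2 * n + 1 - (2 * n - 1 - i) = i + 2 by omega, mul_comm]

theorem eulerSum_of_odd_weight {a b n : ℕ} (ha : 1 ≤ a) (hb : 1 ≤ b) (hn : a + b = 2 * n + 1) :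
    eulerSum {a + 1} (b + 1) = (1 - (-1 : ℝ) ^ (a + 1)) / 2 * (zetaValue (a + 1) * zetaValue (b + 1))
      + 1 / 2 * zetaValue (2 * n + 3) * (1 - (-1 : ℝ) ^ (a + 1) * ((2 * n + 2).choose (b + 1) : ℝ)
        - (-1 : ℝ) ^ (a + 1) * ((2 * n + 2).choose (a + 1) : ℝ))
      + (-1 : ℝ) ^ (a + 1) * ∑ r ∈ Finset.range (n + 1),
        (((2 * n - 2 * r).choose a : ℝ) + ((2 * n - 2 * r).choose b : ℝ))
          * (zetaValue (2 * r + 2) * zetaValue (2 * n - 2 * r + 1)) := by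
  have h := (hasSum_one_div_pow_mul_partialFractions ha hb hn).unique
    (hasSum_int_one_div_pow_mul_fibre (by omega) (by omega))
  rw [Finset.Nat.sum_antidiagonal_eq_sum_range_succ_mk, Nat.succ_eq_add_one,
    sum_range_of_odd_eq_zero] at h
  · have hsum : ∑ r ∈ Finset.range (n + 1),
        (((2 * n - 2 * r).choose a : ℝ) + ((2 * n - 2 * r).choose b : ℝ))
          * ((1 + (-1) ^ (2 * r + 2)) * zetaValue (2 * r + 2)) * zetaValue (2 * n - 2 * r + 1)
        = 2 * ∑ r ∈ Finset.range (n + 1),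
          (((2 * n - 2 * r).choose a : ℝ) + ((2 * n - 2 * r).choose b : ℝ))
            * (zetaValue (2 * r + 2) * zetaValue (2 * n - 2 * r + 1)) := by
      rw [Finset.mul_sum]
      refine Finset.sum_congr rfl fun r _ => ?_
      rw [show 2 * r + 2 = 2 * (r + 1) by ring, pow_mul]
      norm_num
      ring
    -- Odd weight enters here: the two occurrences of `S_{p,q}` reinforce each other instead of
    -- cancelling.
    have hq : (-1 : ℝ) ^ (b + 1) = -(-1) ^ (a + 1) := by
      have h1 : (-1 : ℝ) ^ (b + 1) * (-1) ^ (a + 1) = -1 := by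
        rw [← pow_add]
        exact Odd.neg_one_pow ⟨n + 1, by omega⟩
      rcases neg_one_pow_eq_or ℝ (a + 1) with h2 | h2 <;> rw [h2] at h1 ⊢ <;> linarith
    rw [hsum, hq, show a + 1 + (b + 1) = 2 * n + 3 by omega] at h
    rcases neg_one_pow_eq_or ℝ (a + 1) with h2 | h2 <;> rw [h2] at h ⊢ <;> linarith
  · intro i
    rw [show 2 * i + 1 + 2 = 2 * (i + 1) + 1 by ring, pow_succ, pow_mul]
    norm_num

theorem eulerSum_eq_of_odd {p q w : ℕ} (hp : 1 ≤ p) (hq : 2 ≤ q) (hw : w = p + q) (hodd : Odd w) :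
    eulerSum {p} q = (1 - (-1 : ℝ) ^ p) / 2 * (zetaValue p * zetaValue q)
        + 1 / 2 * zetaValue w
          * (1 - (-1 : ℝ) ^ p * ((w - 1).choose q : ℝ) - (-1 : ℝ) ^ p * ((w - 1).choose p : ℝ))
        + (-1 : ℝ) ^ p * ∑ k ∈ Finset.Icc 1 ((w - 1) / 2),
          (((w - 2 * k - 1).choose (p - 1) : ℝ) + ((w - 2 * k - 1).choose (q - 1) : ℝ))
            * (zetaValue (2 * k) * zetaValue (w - 2 * k)) := by
  obtain ⟨m, hm⟩ := hodd
  obtain ⟨n, rfl⟩ : ∃ n, m = n + 1 := ⟨m - 1, by omega⟩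
  obtain ⟨a, rfl⟩ := Nat.exists_eq_add_of_le' hp
  obtain ⟨b, rfl⟩ := Nat.exists_eq_add_of_le' (by omega : 1 ≤ q)
  have hw' : w = 2 * n + 3 := by omega
  rw [sum_Icc_one_eq_sum_range, hw', show (2 * n + 3 - 1) / 2 = n + 1 by omega,
    show 2 * n + 3 - 1 = 2 * n + 2 by omega, Nat.add_sub_cancel, Nat.add_sub_cancel]
  have hsum : ∑ k ∈ Finset.range (n + 1), (((2 * n + 3 - 2 * (k + 1) - 1).choose a : ℝ)
        + ((2 * n + 3 - 2 * (k + 1) - 1).choose b : ℝ))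
          * (zetaValue (2 * (k + 1)) * zetaValue (2 * n + 3 - 2 * (k + 1)))
      = ∑ r ∈ Finset.range (n + 1),
        (((2 * n - 2 * r).choose a : ℝ) + ((2 * n - 2 * r).choose b : ℝ))
          * (zetaValue (2 * r + 2) * zetaValue (2 * n - 2 * r + 1)) := by
    refine Finset.sum_congr rfl fun k hk => ?_
    have hk := Finset.mem_range.1 hk
    rw [show 2 * n + 3 - 2 * (k + 1) - 1 = 2 * n - 2 * k by omega,
      show 2 * n + 3 - 2 * (k + 1) = 2 * n - 2 * k + 1 by omega, mul_add_one]
  rw [hsum]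
  rcases Nat.eq_zero_or_pos a with rfl | ha
  · obtain rfl : b = 2 * n + 1 := by omega
    rw [zero_add, zetaValue_one, eulerSum_one_of_even, Nat.choose_self, Nat.choose_one_right]
    have : ∑ r ∈ Finset.range (n + 1),
        (((2 * n - 2 * r).choose 0 : ℝ) + ((2 * n - 2 * r).choose (2 * n + 1) : ℝ))
          * (zetaValue (2 * r + 2) * zetaValue (2 * n - 2 * r + 1))
        = ∑ r ∈ Finset.range (n + 1), zetaValue (2 * r + 2) * zetaValue (2 * n + 1 - 2 * r) := by
      refine Finset.sum_congr rfl fun r hr => ?_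
      have hr := Finset.mem_range.1 hr
      rw [Nat.choose_eq_zero_of_lt (by omega : 2 * n - 2 * r < 2 * n + 1),
        show 2 * n - 2 * r + 1 = 2 * n + 1 - 2 * r by omega]
      simp
    rw [this]
    push_cast
    ring
  · exact eulerSum_of_odd_weight ha (by omega) (by omega)

theorem mainTheorem9 :
    (∀ p q : ℕ, 1 ≤ p → 2 ≤ q →
      Summable (eulerSumTerm {p} q) ∧ Summable (mzvTerm ![q, p]) ∧
      eulerSum {p} q = mzv ![q, p] + zetaValue (p + q)) ∧
    (∀ q : ℕ, 2 ≤ q →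
      eulerSum {1} q = ((q : ℝ) / 2 + 1) * zetaValue (q + 1)
        - 1 / 2 * ∑ i ∈ Finset.Icc 1 (q - 2), zetaValue (i + 1) * zetaValue (q - i)) ∧
    (∀ p q w : ℕ, 1 ≤ p → 2 ≤ q → w = p + q → Odd w →
      eulerSum {p} q = (1 - (-1 : ℝ) ^ p) / 2 * (zetaValue p * zetaValue q)
        + 1 / 2 * zetaValue w
          * (1 - (-1 : ℝ) ^ p * ((w - 1).choose q : ℝ) - (-1 : ℝ) ^ p * ((w - 1).choose p : ℝ))
        + (-1 : ℝ) ^ p * ∑ k ∈ Finset.Icc 1 ((w - 1) / 2),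
          (((w - 2 * k - 1).choose (p - 1) : ℝ) + ((w - 2 * k - 1).choose (q - 1) : ℝ))
            * (zetaValue (2 * k) * zetaValue (w - 2 * k))) := by
  refine ⟨fun p q hp hq => ?_, fun q hq => eulerSum_one hq,
    fun p q w hp hq hw hodd => eulerSum_eq_of_odd hp hq hw hodd⟩
  have h := hasSum_mzvTerm_pair hp hq
  refine ⟨summable_eulerSumTerm hp hq, h.summable, ?_⟩
  rw [mzv, h.tsum_eq, sub_add_cancel]
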